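/- Let $\mathscr O$ be a symmetric operad in topological spaces with set of colours $\{1,2\}$ such that $\mathscr O(\ell;2)$ is a point if $\ell$ is the one-entry list $2$ and is empty for every other list $\ell$. Order lists of colours of a fixed length entrywise by $1\le 2$. Suppose that $\mathscr O$ is an \emph{operad with shifts}: there are weak homotopy equivalences $\mathfrak s_{\ell,\ell'}:\mathscr O(\ell;1)\to\mathscr O(\ell';1)$ for all $\ell\le\ell'$ with $\mathfrak s_{\ell,\ell}=\mathrm{id}$, $\mathfrak s_{\ell',\ell''}\mathfrak s_{\ell,\ell'}=\mathfrak s_{\ell,\ell''}$, $\sigma^*\mathfrak s_{\ell,\ell'}=\mathfrak s_{\ell\cdot\sigma,\ell'\cdot\sigma}\sigma^*$ for permutations $\sigma$, and $(\mathfrak s_{\ell,\ell'}x)\circ_i(\mathfrak s_{k,k'}y)=\mathfrak s_{\ell\circ_i k,\,\ell'\circ_i k'}(x\circ_i y)$ whenever $\ell_i=\ell'_i=1$. For a finite rooted tree $T$ let $\Omega(T)$ be the symmetric operad coloured by the edges of $T$ and freely generated by its vertices. Let $\Omega$ be the category whose objects are finite rooted trees and whose maps $S\to T$ are the operad maps $\Omega(S)\to\Omega(T)$,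 and let $\Omega_{\mathrm{inj}}$ be its wide subcategory of maps that are injective on edges (the maps generated by isomorphisms and face maps). A semi-dendroidal space is a presheaf of topological spaces on $\Omega_{\mathrm{inj}}$. Let $X$ be the semi-dendroidal space associated with $\mathscr O$: $X_T$ is the space of operad maps $\Omega(T)\to\mathscr O$ that send the leaves of $T$ to $2$ and all other edges to $1$ (for the tree $\eta$ with one edge and no vertex this is a point); a map $\alpha:S\to T$ of $\Omega_{\mathrm{inj}}$ acts as $\hat\alpha=\mathfrak s_S\,\alpha^*:X_T\to X_S$, where $\alpha^*$ is precomposition with $\alpha$ and $\mathfrak s_S$ recolours all leaves of $S$ by $2$ and applies the corresponding shift map at every vertex of $S$. \textbf{Theorem.} $X$ satisfies the Segal condition: $X_\eta=*$, and for every finite rooted tree $T\neq\eta$ the Segal map $$X_T\longrightarrow\prod_{v\in T}X_{C_v},$$ induced by the inclusions $C_v\to T$ of the corollas at the vertices $v$ of $T$, is a weak homotopy equivalence. -/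

import Mathlib

/-! ### Weak homotopy equivalences -/

universe u v w

namespace Dendro

open CategoryTheory Opposite

section WeakEquivalence

variable {X Y : Type*} [TopologicalSpace X] [TopologicalSpace Y]

/-- The map on sets of path components induced by a continuous map. -/
def pathComponentsMap (f : C(X, Y)) : ZerothHomotopy X → ZerothHomotopy Y :=
  Quotient.map f (fun _ _ h => h.map f.continuous)

/-- Postcomposition of generalised loops with a continuous map. -/
def genLoopMap (f : C(X, Y)) (N : Type*) (x : X) (p : GenLoop N X x) : GenLoop N Y (f x) :=
  ⟨f.comp p.1, fun y hy => congrArg f (p.2 y hy)⟩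

/-- The map induced by a continuous map on homotopy groups. -/
def homotopyGroupMap (f : C(X, Y)) (N : Type*) (x : X) :
    HomotopyGroup N X x → HomotopyGroup N Y (f x) :=
  Quotient.map (genLoopMap f N x) (fun _ _ h => ContinuousMap.HomotopicRel.comp_continuousMap h f)

/-- A continuous map is a weak homotopy equivalence when it induces a bijection on path
components and on all homotopy groups at all base points. -/
def IsWeakHomotopyEquiv (f : C(X, Y)) : Prop :=
  Function.Bijective (pathComponentsMap f) ∧
    ∀ (n : ℕ) (x : X), Function.Bijective (homotopyGroupMap f (Fin n) x)

end WeakEquivalence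

/-! ### Coloured symmetric operads -/

section Operads

/-- `r = l · σ`, for lists of length `n` and `σ ∈ Σ_n`: the `i`-th entry of `r` is the
`σ i`-th entry of `l`. -/
structure IsPerm {C : Type*} {n : ℕ} (σ : Equiv.Perm (Fin n)) (l r : List C) : Prop where
  length_left : l.length = n
  length_right : r.length = n
  getElem : ∀ i : Fin n, r[(i : ℕ)]? = l[(σ i : ℕ)]?

theorem IsPerm.map {C D : Type*} {n : ℕ} {σ : Equiv.Perm (Fin n)} {l r : List C}
    (h : IsPerm σ l r) (f : C → D) : IsPerm σ (l.map f) (r.map f) where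
  length_left := by simpa using h.length_left
  length_right := by simpa using h.length_right
  getElem i := by simp [h.getElem i]

/-- The position, after a list of length `m` has been substituted for the entry at position `p`,
of the entry that was at position `j ≠ p`. -/
def outerPos (p m j : ℕ) : ℕ := if j < p then j else j + m - 1

/-- `ρ` is the block permutation built from `σ ∈ Σ_n` and `τ ∈ Σ_m` by inserting `τ` at the
position `p'` of the source, which `σ` sends to the position `p`. -/
structure IsBlockPerm {n m k : ℕ} (σ : Equiv.Perm (Fin n)) (τ : Equiv.Perm (Fin m)) (p' p : ℕ)
    (ρ : Equiv.Perm (Fin k)) : Prop where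
  size : k + 1 = n + m
  base : ∀ i : Fin n, (i : ℕ) = p' → (σ i : ℕ) = p
  outer : ∀ (j : Fin n) (t : Fin k), (j : ℕ) ≠ p' → (t : ℕ) = outerPos p' m j →
    (ρ t : ℕ) = outerPos p m (σ j)
  inner : ∀ (i : Fin m) (t : Fin k), (t : ℕ) = p' + i → (ρ t : ℕ) = p + τ i

/-- A coloured symmetric operad (in sets) with set of colours `C`, in terms of partial
compositions. The spaces of operations are `Op l c`, for a list `l` of input colours and an output
colour `c`. The partial composition `x ∘_i y` is `comp` for `l = pre ++ a :: post` with
`i = pre.length + 1`, and its list of inputs is `pre ++ l' ++ post`. The action of a permutation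
`σ` is `σ^* : Op l c → Op (l · σ) c`. The lists are only required to be propositionally equal to
the indicated ones, so that all axioms make sense without transport. -/
structure ColoredOperad (C : Type v) where
  Op : List C → C → Type u
  one : ∀ c : C, Op [c] c
  comp : ∀ {pre post l l' r : List C} {a c : C}, l = pre ++ a :: post → r = pre ++ l' ++ post →
    Op l c → Op l' a → Op r c
  act : ∀ {n : ℕ} (σ : Equiv.Perm (Fin n)) {l r : List C} {c : C}, IsPerm σ l r → Op l c → Op r c
  one_comp : ∀ {l : List C} {a : C} (hl : [a] = [] ++ a :: []) (hr : l = [] ++ l ++ [])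
    (y : Op l a), comp hl hr (one a) y = y
  comp_one : ∀ {pre post l : List C} {a c : C} (hl : l = pre ++ a :: post)
    (hr : l = pre ++ [a] ++ post) (x : Op l c), comp hl hr x (one a) = x
  assoc : ∀ {pre post pre' post' l l' l'' r r' s : List C} {a b c : C}
    (hl : l = pre ++ a :: post) (hl' : l' = pre' ++ b :: post')
    (h1 : r = pre ++ l' ++ post) (h2 : r = (pre ++ pre') ++ b :: (post' ++ post))
    (h3 : s = (pre ++ pre') ++ l'' ++ (post' ++ post))
    (k1 : r' = pre' ++ l'' ++ post') (k2 : s = pre ++ r' ++ post)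
    (x : Op l c) (y : Op l' a) (z : Op l'' b),
    comp h2 h3 (comp hl h1 x y) z = comp hl k2 x (comp hl' k1 y z)
  parallel : ∀ {pre mid post l l' l'' r r' s : List C} {a b c : C}
    (h : l = pre ++ a :: (mid ++ b :: post)) (h' : l = (pre ++ a :: mid) ++ b :: post)
    (h1 : r = pre ++ l' ++ (mid ++ b :: post)) (h2 : r = (pre ++ l' ++ mid) ++ b :: post)
    (h3 : s = (pre ++ l' ++ mid) ++ l'' ++ post)
    (k1 : r' = (pre ++ a :: mid) ++ l'' ++ post) (k2 : r' = pre ++ a :: (mid ++ l'' ++ post))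
    (k3 : s = pre ++ l' ++ (mid ++ l'' ++ post))
    (x : Op l c) (y : Op l' a) (z : Op l'' b),
    comp h2 h3 (comp h h1 x y) z = comp k2 k3 (comp h' k1 x z) y
  act_one : ∀ {n : ℕ} {l : List C} {c : C} (h : IsPerm (1 : Equiv.Perm (Fin n)) l l) (x : Op l c),
    act 1 h x = x
  act_mul : ∀ {n : ℕ} {σ τ : Equiv.Perm (Fin n)} {l r s : List C} {c : C} (h : IsPerm σ l r)
    (h' : IsPerm τ r s) (h'' : IsPerm (σ * τ) l s) (x : Op l c),
    act τ h' (act σ h x) = act (σ * τ) h'' x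
  comp_act : ∀ {n m k : ℕ} {σ : Equiv.Perm (Fin n)} {τ : Equiv.Perm (Fin m)}
    {ρ : Equiv.Perm (Fin k)} {pre post pre' post' l r l' r' s s' : List C} {a c : C}
    (hl : l = pre ++ a :: post) (hr : r = pre' ++ a :: post')
    (hs : s = pre ++ l' ++ post) (hs' : s' = pre' ++ r' ++ post')
    (hσ : IsPerm σ l r) (hτ : IsPerm τ l' r') (hρ : IsPerm ρ s s'),
    IsBlockPerm σ τ pre'.length pre.length ρ → ∀ (x : Op l c) (y : Op l' a),
    comp hr hs' (act σ hσ x) (act τ hτ y) = act ρ hρ (comp hl hs x y)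

/-- Transport of operations along equalities of colours. -/
def ColoredOperad.recast {C : Type v} (P : ColoredOperad.{u} C) {l l' : List C} {c c' : C}
    (hl : l = l') (hc : c = c') (x : P.Op l c) : P.Op l' c' :=
  hl ▸ hc ▸ x

theorem ColoredOperad.comp_congr {C : Type v} (P : ColoredOperad.{u} C)
    {pre post pre₁ post₁ l l' r : List C} {a c : C} {hl : l = pre ++ a :: post}
    {hr : r = pre ++ l' ++ post} {hl₁ : l = pre₁ ++ a :: post₁} {hr₁ : r = pre₁ ++ l' ++ post₁}
    {x x₁ : P.Op l c} {y : P.Op l' a} (hpre : pre = pre₁) (hpost : post = post₁) (hx : x = x₁) :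
    P.comp hl hr x y = P.comp hl₁ hr₁ x₁ y := by
  subst hpre hpost hx
  rfl

/-- A coloured symmetric operad in topological spaces. -/
structure TopOperad (C : Type v) extends ColoredOperad.{u} C where
  topology : ∀ (l : List C) (c : C), TopologicalSpace (Op l c)
  continuous_comp : ∀ {pre post l l' r : List C} {a c : C} (hl : l = pre ++ a :: post)
    (hr : r = pre ++ l' ++ post),
    Continuous (fun z : Op l c × Op l' a => comp hl hr z.1 z.2)
  continuous_act : ∀ {n : ℕ} (σ : Equiv.Perm (Fin n)) {l r : List C} {c : C} (h : IsPerm σ l r),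
    Continuous (act σ h : Op l c → Op r c)

instance {C : Type v} (O : TopOperad.{u} C) (l : List C) (c : C) : TopologicalSpace (O.Op l c) :=
  O.topology l c

variable {C : Type*} {D : Type*} {E : Type*}

/-- The maps of coloured operads `P → Q` with a given function `f` on colours. -/
@[ext]
structure OperadMapOver (P : ColoredOperad.{u} C) (Q : ColoredOperad.{w} D) (f : C → D) where
  map : ∀ {l : List C} {c : C}, P.Op l c → Q.Op (l.map f) (f c)
  map_one : ∀ c : C, map (P.one c) = Q.one (f c)
  map_comp : ∀ {pre post l l' r : List C} {a c : C} (hl : l = pre ++ a :: post)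
    (hr : r = pre ++ l' ++ post) (x : P.Op l c) (y : P.Op l' a),
    map (P.comp hl hr x y) =
      Q.comp (pre := pre.map f) (post := post.map f) (by simp [hl]) (by simp [hr]) (map x) (map y)
  map_act : ∀ {n : ℕ} (σ : Equiv.Perm (Fin n)) {l r : List C} {c : C} (h : IsPerm σ l r)
    (x : P.Op l c), map (P.act σ h x) = Q.act σ (h.map f) (map x)

/-- The value of an operad map, transported along equalities of colours. -/
def OperadMapOver.mapTo {P : ColoredOperad.{u} C} {Q : ColoredOperad.{w} D} {f : C → D}
    (F : OperadMapOver P Q f) {l : List C} {c : C} {l' : List D} {c' : D}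
    (hl : l.map f = l') (hc : f c = c') (x : P.Op l c) : Q.Op l' c' :=
  Q.recast hl hc (F.map x)

theorem OperadMapOver.mapTo_comp {P : ColoredOperad.{u} C} {Q : ColoredOperad.{w} D} {f : C → D}
    (F : OperadMapOver P Q f) {pre post l l' r : List C} {a c : C} (hl : l = pre ++ a :: post)
    (hr : r = pre ++ l' ++ post) (x : P.Op l c) (y : P.Op l' a)
    {pre₁ post₁ l₁ l₁' r₁ : List D} {a₁ c₁ : D} (hl₁ : l₁ = pre₁ ++ a₁ :: post₁)
    (hr₁ : r₁ = pre₁ ++ l₁' ++ post₁) (hpre : pre.map f = pre₁) (hpost : post.map f = post₁)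
    (ha : f a = a₁) (hc : f c = c₁) (hl' : l'.map f = l₁') (e₁ : l.map f = l₁)
    (e₂ : r.map f = r₁) :
    F.mapTo e₂ hc (P.comp hl hr x y) = Q.comp hl₁ hr₁ (F.mapTo e₁ hc x) (F.mapTo hl' ha y) := by
  subst hpre hpost ha hc hl' e₁ e₂
  exact F.map_comp hl hr x y

theorem OperadMapOver.mapTo_act {P : ColoredOperad.{u} C} {Q : ColoredOperad.{w} D} {f : C → D}
    (F : OperadMapOver P Q f) {n : ℕ} (σ : Equiv.Perm (Fin n)) {l r : List C} {c : C}
    (h : IsPerm σ l r) (x : P.Op l c) {l₁ r₁ : List D} {c₁ : D} (h₁ : IsPerm σ l₁ r₁)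
    (e₁ : l.map f = l₁) (e₂ : r.map f = r₁) (hc : f c = c₁) :
    F.mapTo e₂ hc (P.act σ h x) = Q.act σ h₁ (F.mapTo e₁ hc x) := by
  subst e₁ e₂ hc
  exact F.map_act σ h x

theorem OperadMapOver.mapTo_one {P : ColoredOperad.{u} C} {Q : ColoredOperad.{w} D} {f : C → D}
    (F : OperadMapOver P Q f) {c : C} {c₁ : D} (e : [c].map f = [c₁]) (hc : f c = c₁) :
    F.mapTo e hc (P.one c) = Q.one c₁ := by
  subst hc
  exact F.map_one c

theorem OperadMapOver.mapTo_recast {P : ColoredOperad.{u} C} {Q : ColoredOperad.{w} D} {f : C → D}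
    (F : OperadMapOver P Q f) {l k : List C} {c d : C} {l' : List D} {c' : D}
    (hl : l = k) (hc : c = d) (hl' : k.map f = l') (hc' : f d = c') (x : P.Op l c) :
    F.mapTo hl' hc' (P.recast hl hc x) = F.mapTo (hl ▸ hl') (hc ▸ hc') x := by
  subst hl hc
  rfl

theorem OperadMapOver.recast_mapTo {P : ColoredOperad.{u} C} {Q : ColoredOperad.{w} D} {f : C → D}
    (F : OperadMapOver P Q f) {l : List C} {c : C} {l' l'' : List D} {c' c'' : D}
    (hl : l.map f = l') (hc : f c = c') (hl' : l' = l'') (hc' : c' = c'') (x : P.Op l c) :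
    Q.recast hl' hc' (F.mapTo hl hc x) = F.mapTo (hl.trans hl') (hc.trans hc') x := by
  subst hl' hc'
  rfl

/-- The identity map of an operad. -/
def OperadMapOver.id (P : ColoredOperad.{u} C) : OperadMapOver P P (_root_.id : C → C) where
  map x := P.recast (by simp) rfl x
  map_one _ := rfl
  map_comp {pre post l l' r a c} hl hr x y := by
    have key : ∀ {p q k k' s : List C} (h₁ : p = pre) (h₂ : q = post) (h₃ : l = k) (h₄ : l' = k')
        (h₅ : r = s) (hk : k = p ++ a :: q) (hs : s = p ++ k' ++ q),
        P.recast h₅ rfl (P.comp hl hr x y) =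
          P.comp hk hs (P.recast h₃ rfl x) (P.recast h₄ rfl y) := by
      intros; subst_vars; rfl
    exact key (by simp) (by simp) _ _ _ _ _
  map_act {n} σ {l r c} h x := by
    have key : ∀ {k s : List C} (h₁ : l = k) (h₂ : r = s) (h' : IsPerm σ k s),
        P.recast h₂ rfl (P.act σ h x) = P.act σ h' (P.recast h₁ rfl x) := by
      intros; subst_vars; rfl
    exact key _ _ _

theorem OperadMapOver.id_mapTo (P : ColoredOperad.{u} C) {l l' : List C} {c : C}
    (hl : l.map _root_.id = l') (x : P.Op l c) :
    (OperadMapOver.id P).mapTo hl rfl x = P.recast ((List.map_id l).symm.trans hl) rfl x := by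
  subst hl
  rfl

/-- Composition of operad maps. -/
def OperadMapOver.comp {P : ColoredOperad.{u} C} {Q : ColoredOperad.{v} D} {R : ColoredOperad.{w} E}
    {f : C → D} {g : D → E} (G : OperadMapOver Q R g) (F : OperadMapOver P Q f) :
    OperadMapOver P R (g ∘ f) where
  map x := G.mapTo (by simp) rfl (F.map x)
  map_one c := by rw [F.map_one]; exact G.mapTo_one _ _
  map_comp hl hr x y := by
    rw [F.map_comp]
    exact G.mapTo_comp _ _ _ _ _ _ (by simp) (by simp) rfl rfl _ _ _
  map_act σ _ _ _ h x := by
    rw [F.map_act]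
    exact G.mapTo_act _ _ _ _ _ _ _

theorem OperadMapOver.comp_mapTo {P : ColoredOperad.{u} C} {Q : ColoredOperad.{v} D}
    {R : ColoredOperad.{w} E} {f : C → D} {g : D → E} (G : OperadMapOver Q R g)
    (F : OperadMapOver P Q f) {l : List C} {c : C} {l' : List D} {c' : D} {l'' : List E} {c'' : E}
    (hl : l.map f = l') (hc : f c = c') (hl' : l'.map g = l'') (hc' : g c' = c'')
    (e : l.map (g ∘ f) = l'') (e' : (g ∘ f) c = c'') (x : P.Op l c) :
    (G.comp F).mapTo e e' x = G.mapTo hl' hc' (F.mapTo hl hc x) := by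
  subst hl hc
  exact G.recast_mapTo (l' := l.map (g ∘ f)) (c' := g (f c)) (by simp) rfl e e' (F.map x)

/-- A map of coloured operads: a function on colours together with compatible functions on
operations. -/
structure OperadMap (P : ColoredOperad.{u} C) (Q : ColoredOperad.{w} D) where
  col : C → D
  hom : OperadMapOver P Q col

theorem OperadMap.ext' {P : ColoredOperad.{u} C} {Q : ColoredOperad.{w} D} {F G : OperadMap P Q}
    (h : F.col = G.col)
    (H : ∀ (l : List C) (c : C) (x : P.Op l c),
      F.hom.mapTo (by rw [h]) (by rw [h]) x = G.hom.map x) : F = G := by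
  obtain ⟨f, F⟩ := F
  obtain ⟨g, G⟩ := G
  dsimp only at h
  subst h
  congr 1
  ext l c x
  exact H l c x

/-- The space of maps over `f` into a topological operad has the topology of pointwise
convergence, as a subspace of the product of the spaces `O(f l; f c)` over all operations. -/
instance {P : ColoredOperad.{u} C} {O : TopOperad.{w} D} {f : C → D} :
    TopologicalSpace (OperadMapOver P O.toColoredOperad f) :=
  TopologicalSpace.induced
    (fun (F : OperadMapOver P O.toColoredOperad f) (p : Σ (l : List C) (c : C), P.Op l c) =>
      F.map p.2.2)
    inferInstance

/-! ### Free operads -/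

/-- Formal composites of generators. -/
inductive FreeTerm {C : Type} (G : List C → C → Type) : List C → C → Type
  | gen {l : List C} {c : C} (g : G l c) : FreeTerm G l c
  | one (c : C) : FreeTerm G [c] c
  | comp {pre post l l' r : List C} {a c : C} (hl : l = pre ++ a :: post)
      (hr : r = pre ++ l' ++ post) (x : FreeTerm G l c) (y : FreeTerm G l' a) : FreeTerm G r c
  | act {n : ℕ} (σ : Equiv.Perm (Fin n)) {l r : List C} {c : C} (h : IsPerm σ l r)
      (x : FreeTerm G l c) : FreeTerm G r c

/-- The relations that have to be imposed on formal composites: the operad axioms, closed under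
composition and permutation. -/
inductive FreeRel {C : Type} (G : List C → C → Type) :
    ∀ {l : List C} {c : C}, FreeTerm G l c → FreeTerm G l c → Prop
  | comp_left {pre post l l' r : List C} {a c : C} (hl : l = pre ++ a :: post)
      (hr : r = pre ++ l' ++ post) {x x' : FreeTerm G l c} (y : FreeTerm G l' a) :
      FreeRel G x x' → FreeRel G (.comp hl hr x y) (.comp hl hr x' y)
  | comp_right {pre post l l' r : List C} {a c : C} (hl : l = pre ++ a :: post)
      (hr : r = pre ++ l' ++ post) (x : FreeTerm G l c) {y y' : FreeTerm G l' a} :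
      FreeRel G y y' → FreeRel G (.comp hl hr x y) (.comp hl hr x y')
  | act_congr {n : ℕ} (σ : Equiv.Perm (Fin n)) {l r : List C} {c : C} (h : IsPerm σ l r)
      {x x' : FreeTerm G l c} : FreeRel G x x' → FreeRel G (.act σ h x) (.act σ h x')
  | one_comp {l : List C} {a : C} (hl : [a] = [] ++ a :: []) (hr : l = [] ++ l ++ [])
      (y : FreeTerm G l a) : FreeRel G (.comp hl hr (.one a) y) y
  | comp_one {pre post l : List C} {a c : C} (hl : l = pre ++ a :: post)
      (hr : l = pre ++ [a] ++ post) (x : FreeTerm G l c) : FreeRel G (.comp hl hr x (.one a)) x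
  | assoc {pre post pre' post' l l' l'' r r' s : List C} {a b c : C}
      (hl : l = pre ++ a :: post) (hl' : l' = pre' ++ b :: post')
      (h1 : r = pre ++ l' ++ post) (h2 : r = (pre ++ pre') ++ b :: (post' ++ post))
      (h3 : s = (pre ++ pre') ++ l'' ++ (post' ++ post))
      (k1 : r' = pre' ++ l'' ++ post') (k2 : s = pre ++ r' ++ post)
      (x : FreeTerm G l c) (y : FreeTerm G l' a) (z : FreeTerm G l'' b) :
      FreeRel G (.comp h2 h3 (.comp hl h1 x y) z) (.comp hl k2 x (.comp hl' k1 y z))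
  | parallel {pre mid post l l' l'' r r' s : List C} {a b c : C}
      (h : l = pre ++ a :: (mid ++ b :: post)) (h' : l = (pre ++ a :: mid) ++ b :: post)
      (h1 : r = pre ++ l' ++ (mid ++ b :: post)) (h2 : r = (pre ++ l' ++ mid) ++ b :: post)
      (h3 : s = (pre ++ l' ++ mid) ++ l'' ++ post)
      (k1 : r' = (pre ++ a :: mid) ++ l'' ++ post) (k2 : r' = pre ++ a :: (mid ++ l'' ++ post))
      (k3 : s = pre ++ l' ++ (mid ++ l'' ++ post))
      (x : FreeTerm G l c) (y : FreeTerm G l' a) (z : FreeTerm G l'' b) :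
      FreeRel G (.comp h2 h3 (.comp h h1 x y) z) (.comp k2 k3 (.comp h' k1 x z) y)
  | act_one {n : ℕ} {l : List C} {c : C} (h : IsPerm (1 : Equiv.Perm (Fin n)) l l)
      (x : FreeTerm G l c) : FreeRel G (.act 1 h x) x
  | act_mul {n : ℕ} {σ τ : Equiv.Perm (Fin n)} {l r s : List C} {c : C} (h : IsPerm σ l r)
      (h' : IsPerm τ r s) (h'' : IsPerm (σ * τ) l s) (x : FreeTerm G l c) :
      FreeRel G (.act τ h' (.act σ h x)) (.act (σ * τ) h'' x)
  | comp_act {n m k : ℕ} {σ : Equiv.Perm (Fin n)} {τ : Equiv.Perm (Fin m)}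
      {ρ : Equiv.Perm (Fin k)} {pre post pre' post' l r l' r' s s' : List C} {a c : C}
      (hl : l = pre ++ a :: post) (hr : r = pre' ++ a :: post')
      (hs : s = pre ++ l' ++ post) (hs' : s' = pre' ++ r' ++ post')
      (hσ : IsPerm σ l r) (hτ : IsPerm τ l' r') (hρ : IsPerm ρ s s')
      (hb : IsBlockPerm σ τ pre'.length pre.length ρ) (x : FreeTerm G l c) (y : FreeTerm G l' a) :
      FreeRel G (.comp hr hs' (.act σ hσ x) (.act τ hτ y)) (.act ρ hρ (.comp hl hs x y))

/-- The free coloured symmetric operad on a collection of generators. -/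
def freeOperad {C : Type} (G : List C → C → Type) : ColoredOperad.{0} C where
  Op l c := Quot (FreeRel G (l := l) (c := c))
  one c := Quot.mk _ (.one c)
  comp hl hr := Quot.map₂ (FreeTerm.comp hl hr) (fun x _ _ h => .comp_right hl hr x h)
    (fun _ _ y h => .comp_left hl hr y h)
  act σ _ _ _ h := Quot.map (FreeTerm.act σ h) (fun _ _ h' => .act_congr σ h h')
  one_comp hl hr := by rintro ⟨y⟩; exact Quot.sound (.one_comp hl hr y)
  comp_one hl hr := by rintro ⟨x⟩; exact Quot.sound (.comp_one hl hr x)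
  assoc hl hl' h1 h2 h3 k1 k2 := by
    rintro ⟨x⟩ ⟨y⟩ ⟨z⟩; exact Quot.sound (.assoc hl hl' h1 h2 h3 k1 k2 x y z)
  parallel h h' h1 h2 h3 k1 k2 k3 := by
    rintro ⟨x⟩ ⟨y⟩ ⟨z⟩; exact Quot.sound (.parallel h h' h1 h2 h3 k1 k2 k3 x y z)
  act_one h := by rintro ⟨x⟩; exact Quot.sound (.act_one h x)
  act_mul h h' h'' := by rintro ⟨x⟩; exact Quot.sound (.act_mul h h' h'' x)
  comp_act hl hr hs hs' hσ hτ hρ hb := by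
    rintro ⟨x⟩ ⟨y⟩; exact Quot.sound (.comp_act hl hr hs hs' hσ hτ hρ hb x y)

/-- The generators of a free operad. -/
def freeGen {C : Type} {G : List C → C → Type} {l : List C} {c : C} (g : G l c) :
    (freeOperad G).Op l c :=
  Quot.mk _ (.gen g)

/-- Induction over the operations of a free operad. -/
theorem freeOperad_induction {C : Type} {G : List C → C → Type}
    {motive : ∀ (l : List C) (c : C), (freeOperad G).Op l c → Prop}
    (gen : ∀ (l : List C) (c : C) (g : G l c), motive l c (freeGen g))
    (one : ∀ c : C, motive [c] c ((freeOperad G).one c))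
    (comp : ∀ {pre post l l' r : List C} {a c : C} (hl : l = pre ++ a :: post)
      (hr : r = pre ++ l' ++ post) (x : (freeOperad G).Op l c) (y : (freeOperad G).Op l' a),
      motive l c x → motive l' a y → motive r c ((freeOperad G).comp hl hr x y))
    (act : ∀ {n : ℕ} (σ : Equiv.Perm (Fin n)) {l r : List C} {c : C} (h : IsPerm σ l r)
      (x : (freeOperad G).Op l c), motive l c x → motive r c ((freeOperad G).act σ h x))
    {l : List C} {c : C} (x : (freeOperad G).Op l c) : motive l c x := by
  revert x
  refine Quot.ind (fun t => ?_)
  induction t with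
  | gen g => exact gen _ _ g
  | one c => exact one c
  | comp hl hr x y ihx ihy => exact comp hl hr (Quot.mk _ x) (Quot.mk _ y) ihx ihy
  | act σ h x ih => exact act σ h (Quot.mk _ x) ih

/-- Evaluation of a formal composite in an operad. -/
def FreeTerm.eval {C : Type} {D : Type*} {G : List C → C → Type} {Q : ColoredOperad.{w} D}
    {f : C → D} (φ : ∀ (l : List C) (c : C), G l c → Q.Op (l.map f) (f c)) :
    ∀ {l : List C} {c : C}, FreeTerm G l c → Q.Op (l.map f) (f c)
  | _, _, .gen g => φ _ _ g
  | _, _, .one c => Q.one (f c)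
  | _, _, .comp (pre := pre) (post := post) hl hr x y =>
      Q.comp (pre := pre.map f) (post := post.map f) (by simp [hl]) (by simp [hr])
        (x.eval φ) (y.eval φ)
  | _, _, .act σ h x => Q.act σ (h.map f) (x.eval φ)

theorem FreeTerm.eval_eq {C : Type} {D : Type*} {G : List C → C → Type} {Q : ColoredOperad.{w} D}
    {f : C → D} (φ : ∀ (l : List C) (c : C), G l c → Q.Op (l.map f) (f c))
    {l : List C} {c : C} {x y : FreeTerm G l c} (h : FreeRel G x y) : x.eval φ = y.eval φ := by
  induction h with
  | comp_left hl hr y _ ih => simp only [FreeTerm.eval, ih]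
  | comp_right hl hr y _ ih => simp only [FreeTerm.eval, ih]
  | act_congr σ h _ ih => simp only [FreeTerm.eval, ih]
  | one_comp hl hr y => exact Q.one_comp _ _ _
  | comp_one hl hr x => exact Q.comp_one _ _ _
  | @assoc pre post pre' post' l l' l'' r r' s a b c hl hl' h1 h2 h3 k1 k2 x y z =>
    have key := Q.assoc (pre := pre.map f) (post := post.map f) (pre' := pre'.map f)
      (post' := post'.map f) (l := l.map f) (l' := l'.map f) (l'' := l''.map f) (r := r.map f)
      (r' := r'.map f) (s := s.map f)
      (by simp [hl]) (by simp [hl']) (by simp [h1]) (by simp [h2]) (by simp [h3])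
      (by simp [k1]) (by simp [k2]) (x.eval φ) (y.eval φ) (z.eval φ)
    simp only [FreeTerm.eval]
    exact (Q.comp_congr (by simp) (by simp) rfl).trans key
  | @parallel pre mid post l l' l'' r r' s a b c h h' h1 h2 h3 k1 k2 k3 x y z =>
    have key := Q.parallel (pre := pre.map f) (mid := mid.map f) (post := post.map f)
      (l := l.map f) (l' := l'.map f) (l'' := l''.map f) (r := r.map f)
      (r' := r'.map f) (s := s.map f)
      (by simp [h]) (by simp [h']) (by simp [h1]) (by simp [h2]) (by simp [h3])
      (by simp [k1]) (by simp [k2]) (by simp [k3]) (x.eval φ) (y.eval φ) (z.eval φ)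
    simp only [FreeTerm.eval]
    refine Eq.trans ?_ (key.trans ?_)
    · exact Q.comp_congr (by simp) rfl (Q.comp_congr rfl (by simp) rfl)
    · exact Q.comp_congr rfl (by simp) (Q.comp_congr (by simp) rfl rfl)
  | act_one h x => exact Q.act_one _ _
  | act_mul h h' h'' x => exact Q.act_mul _ _ _ _
  | comp_act hl hr hs hs' hσ hτ hρ hb x y =>
    exact Q.comp_act _ _ _ _ _ _ _ (by simpa using hb) _ _

/-- The universal property of the free operad: a map out of it is determined by the values on
generators, which may be chosen freely. -/
def freeLift {C : Type} {D : Type*} {G : List C → C → Type} {Q : ColoredOperad.{w} D}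
    {f : C → D} (φ : ∀ (l : List C) (c : C), G l c → Q.Op (l.map f) (f c)) :
    OperadMapOver (freeOperad G) Q f where
  map := Quot.lift (FreeTerm.eval φ) (fun _ _ h => FreeTerm.eval_eq φ h)
  map_one _ := rfl
  map_comp hl hr := by rintro ⟨x⟩ ⟨y⟩; rfl
  map_act σ _ _ _ h := by rintro ⟨x⟩; rfl

theorem freeLift_gen {C : Type} {D : Type*} {G : List C → C → Type} {Q : ColoredOperad.{w} D}
    {f : C → D} (φ : ∀ (l : List C) (c : C), G l c → Q.Op (l.map f) (f c))
    {l : List C} {c : C} (g : G l c) : (freeLift φ).map (freeGen g) = φ l c g := rfl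

theorem freeOperad_hom_ext {C : Type} {D : Type*} {G : List C → C → Type} {Q : ColoredOperad.{w} D}
    {f : C → D} {F F' : OperadMapOver (freeOperad G) Q f}
    (H : ∀ (l : List C) (c : C) (g : G l c), F.map (freeGen g) = F'.map (freeGen g)) :
    F = F' := by
  ext l c x
  induction x using freeOperad_induction with
  | gen l c g => exact H l c g
  | one c => rw [F.map_one, F'.map_one]
  | comp hl hr x y ihx ihy => rw [F.map_comp, F'.map_comp, ihx, ihy]
  | act σ h x ih => rw [F.map_act, F'.map_act, ih]

theorem continuous_freeLift {Z : Type*} [TopologicalSpace Z] {C : Type} {D : Type*}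
    {G : List C → C → Type} {O : TopOperad.{w} D} {f : C → D}
    (φ : Z → ∀ (l : List C) (c : C), G l c → O.Op (l.map f) (f c))
    (hφ : ∀ (l : List C) (c : C) (g : G l c), Continuous (fun z => φ z l c g)) :
    Continuous (fun z => (freeLift (φ z) : OperadMapOver (freeOperad G) O.toColoredOperad f)) := by
  refine continuous_induced_rng.2 (continuous_pi fun ⟨l, c, x⟩ => ?_)
  change Continuous (fun z => (freeLift (φ z)).map x)
  induction x using freeOperad_induction with
  | gen l c g => exact hφ l c g
  | one c => exact continuous_const
  | comp hl hr x y ihx ihy =>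
    simp only [OperadMapOver.map_comp]
    exact (O.continuous_comp _ _).comp (ihx.prodMk ihy)
  | act σ h x ih =>
    simp only [OperadMapOver.map_act]
    exact (O.continuous_act _ _).comp ih

theorem continuous_operadMap_apply {P : ColoredOperad.{u} C} {O : TopOperad.{w} D} {f : C → D}
    {l : List C} {c : C} (x : P.Op l c) :
    Continuous (fun F : OperadMapOver P O.toColoredOperad f => F.map x) := by
  have h : Continuous (fun (F : OperadMapOver P O.toColoredOperad f)
      (p : Σ (l : List C) (c : C), P.Op l c) => F.map p.2.2) := continuous_induced_dom
  exact (continuous_pi_iff.1 h) ⟨l, c, x⟩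

theorem continuous_recast {O : TopOperad.{w} D} {l l' : List D} {c c' : D} (hl : l = l')
    (hc : c = c') : Continuous (O.recast hl hc) := by
  subst hl hc
  exact continuous_id

end Operads

/-! ### Operads with shifts -/

section Shifts

/-- The set of colours `{1, 2}`. -/
inductive Color : Type
  | one
  | two

/-- The order `1 ≤ 2` on colours. -/
def Color.le (a b : Color) : Prop := a = .one ∨ b = .two

/-- The entrywise order on lists of colours of the same length. -/
abbrev ListLE (l l' : List Color) : Prop := List.Forall₂ Color.le l l'

/-- An operad with shifts: a topological operad with colours `{1, 2}` for which `O(l; 2)` is a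
point for `l = 2` and empty otherwise, with weak homotopy equivalences `O(l; 1) → O(l'; 1)` for
`l ≤ l'`, which are functorial and compatible with partial compositions along the colour `1` and
with permutations. -/
structure OperadWithShifts extends TopOperad.{u} Color where
  subsingleton_two : Subsingleton (Op [Color.two] Color.two)
  isEmpty_two : ∀ l : List Color, l ≠ [Color.two] → IsEmpty (Op l Color.two)
  shift : ∀ {l l' : List Color}, ListLE l l' → C(Op l Color.one, Op l' Color.one)
  isWeakHomotopyEquiv_shift : ∀ {l l' : List Color} (h : ListLE l l'),
    IsWeakHomotopyEquiv (shift h)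
  shift_refl : ∀ {l : List Color} (h : ListLE l l) (x : Op l Color.one), shift h x = x
  shift_shift : ∀ {l l' l'' : List Color} (h : ListLE l l') (h' : ListLE l' l'')
    (h'' : ListLE l l'') (x : Op l Color.one), shift h' (shift h x) = shift h'' x
  comp_shift : ∀ {pre post pre' post' l l' k k' r r' : List Color}
    (hl : l = pre ++ Color.one :: post) (hl' : l' = pre' ++ Color.one :: post')
    (hr : r = pre ++ k ++ post) (hr' : r' = pre' ++ k' ++ post'), pre.length = pre'.length →
    ∀ (h : ListLE l l') (hk : ListLE k k') (h' : ListLE r r')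
    (x : Op l Color.one) (y : Op k Color.one),
    comp hl' hr' (shift h x) (shift hk y) = shift h' (comp hl hr x y)
  act_shift : ∀ {n : ℕ} (σ : Equiv.Perm (Fin n)) {l l' r r' : List Color} (h : IsPerm σ l r)
    (h' : IsPerm σ l' r') (hl : ListLE l l') (hr : ListLE r r') (x : Op l Color.one),
    act σ h' (shift hl x) = shift hr (act σ h x)

variable (O : OperadWithShifts.{u})

/-- The shift map, for output colours that are only propositionally equal to `1`. -/
def OperadWithShifts.shiftTo {l l' : List Color} {c c' : Color} (hc : c = Color.one)
    (hc' : c' = Color.one) (h : ListLE l l') (x : O.Op l c) : O.Op l' c' :=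
  O.recast rfl hc'.symm (O.shift h (O.recast rfl hc x))

theorem OperadWithShifts.continuous_shiftTo {l l' : List Color} {c c' : Color} (hc : c = Color.one)
    (hc' : c' = Color.one) (h : ListLE l l') : Continuous (O.shiftTo hc hc' h) :=
  (continuous_recast _ _).comp ((O.shift h).continuous.comp (continuous_recast _ _))

theorem OperadWithShifts.shiftTo_eq_recast {l l' : List Color} {c c' : Color} (hc : c = Color.one)
    (hc' : c' = Color.one) (h : ListLE l l') (hl : l = l') (x : O.Op l c) :
    O.shiftTo hc hc' h x = O.recast hl (hc.trans hc'.symm) x := by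
  subst hc hc' hl
  exact O.shift_refl h x

theorem OperadWithShifts.shiftTo_one {c c' : Color} (hc : c = Color.one) (hc' : c' = Color.one)
    (h : ListLE [c] [c']) : O.shiftTo hc hc' h (O.one c) = O.one c' := by
  subst hc hc'
  exact O.shift_refl h _

theorem OperadWithShifts.shiftTo_recast {k l l' : List Color} {b c c' : Color} (hk : k = l)
    (hb : b = c) (hc : c = Color.one) (hc' : c' = Color.one) (h : ListLE l l') (x : O.Op k b) :
    O.shiftTo hc hc' h (O.recast hk hb x) = O.shiftTo (hb.trans hc) hc' (hk ▸ h) x := by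
  subst hk hb
  rfl

theorem OperadWithShifts.recast_shiftTo {l l' k : List Color} {c c' d : Color} (hc : c = Color.one)
    (hc' : c' = Color.one) (h : ListLE l l') (hk : l' = k) (hd : c' = d) (x : O.Op l c) :
    O.recast hk hd (O.shiftTo hc hc' h x) = O.shiftTo hc (hd ▸ hc') (hk ▸ h) x := by
  subst hk hd
  rfl

theorem OperadWithShifts.shiftTo_shiftTo {l l' l'' : List Color} {c c' c'' : Color}
    (hc : c = Color.one) (hc' : c' = Color.one) (hc'' : c'' = Color.one)
    (h : ListLE l l') (h' : ListLE l' l'') (h'' : ListLE l l'') (x : O.Op l c) :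
    O.shiftTo hc' hc'' h' (O.shiftTo hc hc' h x) = O.shiftTo hc hc'' h'' x := by
  subst hc hc' hc''
  exact O.shift_shift h h' h'' x

theorem OperadWithShifts.comp_shiftTo {pre post pre' post' l l' k k' r r' : List Color}
    {a a' c c' : Color} (hl : l = pre ++ a :: post) (hl' : l' = pre' ++ a' :: post')
    (hr : r = pre ++ k ++ post) (hr' : r' = pre' ++ k' ++ post') (hlen : pre.length = pre'.length)
    (ha : a = Color.one) (ha' : a' = Color.one) (hc : c = Color.one) (hc' : c' = Color.one)
    (h : ListLE l l') (hk : ListLE k k') (h' : ListLE r r') (x : O.Op l c) (y : O.Op k a) :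
    O.comp hl' hr' (O.shiftTo hc hc' h x) (O.shiftTo ha ha' hk y) =
      O.shiftTo hc hc' h' (O.comp hl hr x y) := by
  subst ha ha' hc hc'
  exact O.comp_shift hl hl' hr hr' hlen h hk h' x y

theorem OperadWithShifts.act_shiftTo {n : ℕ} (σ : Equiv.Perm (Fin n)) {l l' r r' : List Color}
    {c c' : Color} (hc : c = Color.one) (hc' : c' = Color.one) (h : IsPerm σ l r)
    (h' : IsPerm σ l' r') (hl : ListLE l l') (hr : ListLE r r') (x : O.Op l c) :
    O.act σ h' (O.shiftTo hc hc' hl x) = O.shiftTo hc hc' hr (O.act σ h x) := by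
  subst hc hc'
  exact O.act_shift σ h h' hl hr x

end Shifts

/-! ### Trees and the dendroidal category -/

section Trees

/-- A finite rooted tree with a planar structure: `out v` is the output edge of the vertex `v`,
and `inp v` is the list of its input edges. Edges need not have vertices at both ends, and a
vertex may have no inputs. -/
structure PlanarTree where
  Edge : Type
  Vertex : Type
  finite_edge : Finite Edge
  finite_vertex : Finite Vertex
  root : Edge
  out : Vertex → Edge
  inp : Vertex → List Edge
  out_injective : Function.Injective out
  inp_nodup : ∀ v, (inp v).Nodup
  inp_disjoint : ∀ {e v w}, e ∈ inp v → e ∈ inp w → v = w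
  root_notMem_inp : ∀ v, root ∉ inp v
  reaches_root : ∀ e, Relation.ReflTransGen (fun a b => ∃ v, a ∈ inp v ∧ b = out v) e root

namespace PlanarTree

/-- A leaf is an edge that is not the output of a vertex. -/
def IsLeaf (T : PlanarTree) (e : T.Edge) : Prop := ∀ v, T.out v ≠ e

theorem not_isLeaf_out (T : PlanarTree) (v : T.Vertex) : ¬ T.IsLeaf (T.out v) := fun h => h v rfl

theorem out_notMem_inp (T : PlanarTree) (v : T.Vertex) : T.out v ∉ T.inp v := by
  intro h
  have key : ∀ e, Relation.ReflTransGen (fun a b => ∃ v, a ∈ T.inp v ∧ b = T.out v) (T.out v) e →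
      e = T.out v := by
    intro e he
    induction he with
    | refl => rfl
    | tail _ hbc ih =>
      obtain ⟨w, hw, rfl⟩ := hbc
      subst ih
      rw [T.inp_disjoint hw h]
  exact T.root_notMem_inp v (key _ (T.reaches_root _) ▸ h)

/-- The generators of `Ω(T)`: one operation with inputs `inp v` and output `out v` for every
vertex `v`. -/
def Generator (T : PlanarTree) (l : List T.Edge) (e : T.Edge) : Type :=
  { v : T.Vertex // T.inp v = l ∧ T.out v = e }

/-- The operad `Ω(T)`, coloured by the edges of `T` and freely generated by the vertices. -/
abbrev operad (T : PlanarTree) : ColoredOperad.{0} T.Edge := freeOperad T.Generator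

/-- The operation of `Ω(T)` given by a vertex. -/
def vertexOp (T : PlanarTree) (v : T.Vertex) : T.operad.Op (T.inp v) (T.out v) :=
  freeGen (⟨v, rfl, rfl⟩ : T.Generator (T.inp v) (T.out v))

/-- The tree `η` with one edge and no vertex. -/
def eta : PlanarTree where
  Edge := Unit
  Vertex := Empty
  finite_edge := inferInstance
  finite_vertex := inferInstance
  root := ()
  out := Empty.elim
  inp := Empty.elim
  out_injective := fun v => v.elim
  inp_nodup := fun v => v.elim
  inp_disjoint := fun {_ v} => v.elim
  root_notMem_inp := fun v => v.elim
  reaches_root := fun _ => .refl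

/-- The corolla with `k` inputs; the root is `none`. -/
def corolla (k : ℕ) : PlanarTree where
  Edge := Option (Fin k)
  Vertex := Unit
  finite_edge := inferInstance
  finite_vertex := inferInstance
  root := none
  out := fun _ => none
  inp := fun _ => (List.finRange k).map some
  out_injective := fun _ _ _ => rfl
  inp_nodup := fun _ => (List.nodup_finRange k).map (Option.some_injective _)
  inp_disjoint := fun _ _ => rfl
  root_notMem_inp := fun _ => by simp
  reaches_root := fun e => by
    cases e with
    | none => exact .refl
    | some i => exact .single ⟨(), by simp, rfl⟩

/-- A map of the dendroidal category `Ω` is a map of the associated operads. -/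
instance : Category PlanarTree where
  Hom S T := OperadMap S.operad T.operad
  id T := ⟨_root_.id, OperadMapOver.id T.operad⟩
  comp F G := ⟨G.col ∘ F.col, G.hom.comp F.hom⟩
  id_comp F := by
    refine OperadMap.ext' rfl (fun l c x => ?_)
    refine (F.hom.comp_mapTo (OperadMapOver.id _) (l' := l) (c' := c) (List.map_id l) rfl rfl rfl
      rfl rfl x).trans ?_
    rw [OperadMapOver.id_mapTo]
    rfl
  comp_id F := by
    refine OperadMap.ext' rfl (fun l c x => ?_)
    exact ((OperadMapOver.id _).comp_mapTo F.hom rfl rfl (by simp) rfl (by simp) rfl x).trans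
      (OperadMapOver.id_mapTo _ _ _)
  assoc F G H := by
    refine OperadMap.ext' rfl (fun l c x => ?_)
    refine (H.hom.comp_mapTo (G.hom.comp F.hom) (l' := (l.map F.col).map G.col) (by simp) rfl
      (by simp) rfl _ rfl x).trans ?_
    rw [G.hom.comp_mapTo F.hom rfl rfl rfl rfl]
    refine Eq.symm (((H.hom.comp G.hom).comp_mapTo F.hom rfl rfl (by simp) rfl rfl rfl x).trans ?_)
    exact H.hom.comp_mapTo G.hom rfl rfl _ rfl _ rfl _

/-- The maps of `Ω_inj` are the maps of `Ω` that are injective on edges. (These are the composites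
of face maps and isomorphisms.) -/
def edgeInjective : MorphismProperty PlanarTree := fun _ _ α => Function.Injective α.col

instance : edgeInjective.IsMultiplicative where
  id_mem _ := Function.injective_id
  comp_mem _ _ hα hβ := hβ.comp hα

end PlanarTree

/-- The category `Ω_inj`, as a wide subcategory of `Ω`. -/
abbrev OmegaInj := WideSubcategory PlanarTree.edgeInjective

end Trees

/-! ### The semi-dendroidal space of an operad with shifts -/

section Associated

variable (O : OperadWithShifts.{u})

open scoped Classical in
/-- The colouring that sends the leaves to `2` and all other edges to `1`. For a tree with at least
one vertex, the edges that are not leaves are the internal edges and the root. -/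
noncomputable def PlanarTree.color (T : PlanarTree) (e : T.Edge) : Color :=
  if T.IsLeaf e then Color.two else Color.one

theorem PlanarTree.color_of_not_isLeaf {T : PlanarTree} {e : T.Edge} (h : ¬ T.IsLeaf e) :
    T.color e = Color.one := if_neg h

theorem PlanarTree.color_of_isLeaf {T : PlanarTree} {e : T.Edge} (h : T.IsLeaf e) :
    T.color e = Color.two := if_pos h

/-- The space `X_T` of all operad maps `Ω(T) → O` that send the leaves to `2` and the root and the
internal edges to `1`. For `T = η` there is only the colour condition for the one leaf, and `X_η`
is a point. -/
abbrev XSpace (T : PlanarTree) : Type u :=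
  OperadMapOver T.operad O.toColoredOperad T.color

theorem listLE_color {T : PlanarTree} {f : T.Edge → Color}
    (hf : ∀ e, ¬ T.IsLeaf e → f e = Color.one) (l : List T.Edge) :
    ListLE (l.map f) (l.map T.color) := by
  rw [ListLE, List.forall₂_map_left_iff, List.forall₂_map_right_iff, List.forall₂_same]
  intro e _
  by_cases h : T.IsLeaf e
  · exact Or.inr (T.color_of_isLeaf h)
  · exact Or.inl (hf e h)

/-- The map `𝔰_T`, on the operad maps `Ω(T) → O` that send all edges other than leaves to `1`: the
leaves are recoloured by `2`, and the value at every vertex is shifted accordingly. -/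
noncomputable def shiftLeaves {T : PlanarTree} {f : T.Edge → Color}
    (hf : ∀ e, ¬ T.IsLeaf e → f e = Color.one) (F : OperadMapOver T.operad O.toColoredOperad f) :
    XSpace O T :=
  freeLift fun l e v =>
    O.shiftTo (hf e fun h => h v.1 v.2.2)
      (PlanarTree.color_of_not_isLeaf fun h => h v.1 v.2.2) (listLE_color hf l)
      (F.map (freeGen v))

theorem isLeaf_operation {T : PlanarTree} {l : List T.Edge} {e : T.Edge} (x : T.operad.Op l e)
    (he : T.IsLeaf e) : ∃ h : [e] = l, T.operad.recast h rfl (T.operad.one e) = x := by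
  induction x using freeOperad_induction with
  | gen l c g => exact absurd g.2.2 (he g.1)
  | one c => exact ⟨rfl, rfl⟩
  | @comp pre post l l' r a c hl hr x y ihx ihy =>
    obtain ⟨rfl, rfl⟩ := ihx he
    obtain ⟨rfl, h⟩ : pre = [] ∧ [c] = a :: post := by
      cases pre with
      | nil => exact ⟨rfl, hl⟩
      | cons b pre => simp at hl
    obtain ⟨rfl, rfl⟩ : c = a ∧ post = [] := by simpa using h
    obtain ⟨rfl, rfl⟩ := ihy he
    subst hr
    exact ⟨rfl, (T.operad.one_comp _ _ _).symm⟩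
  | @act n σ l r c h x ih =>
    obtain ⟨rfl, rfl⟩ := ih he
    obtain rfl : 1 = n := h.length_left
    obtain rfl : σ = 1 := Subsingleton.elim _ _
    obtain ⟨b, rfl⟩ := List.length_eq_one_iff.1 h.length_right
    have := h.getElem 0
    obtain rfl : b = c := by simpa using this
    exact ⟨rfl, (T.operad.act_one _ _).symm⟩

/-- The value of `𝔰_T F` at all operations of `Ω(T)`, not only at the vertices. -/
theorem shiftLeaves_map {T : PlanarTree} {f : T.Edge → Color}
    (hf : ∀ e, ¬ T.IsLeaf e → f e = Color.one) (F : OperadMapOver T.operad O.toColoredOperad f)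
    {l : List T.Edge} {e : T.Edge} (x : T.operad.Op l e) (he : ¬ T.IsLeaf e) :
    (shiftLeaves O hf F).map x =
      O.shiftTo (hf e he) (PlanarTree.color_of_not_isLeaf he) (listLE_color hf l) (F.map x) := by
  induction x using freeOperad_induction with
  | gen l c g => rfl
  | one c =>
    rw [OperadMapOver.map_one, OperadMapOver.map_one]
    exact (O.shiftTo_one _ _ _).symm
  | @comp pre post l l' r a c hl hr x y ihx ihy =>
    by_cases ha : T.IsLeaf a
    · obtain ⟨rfl, rfl⟩ := isLeaf_operation y ha
      obtain rfl : l = r := by rw [hl, hr]; simp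
      have e : T.operad.comp hl hr x (T.operad.one a) = x := T.operad.comp_one _ _ _
      change (shiftLeaves O hf F).map (T.operad.comp hl hr x (T.operad.one a)) =
        O.shiftTo _ _ _ (F.map (T.operad.comp hl hr x (T.operad.one a)))
      rw [e]
      exact ihx he
    · change (shiftLeaves O hf F).map (T.operad.comp hl hr x y) =
        O.shiftTo _ _ _ (F.map (T.operad.comp hl hr x y))
      rw [OperadMapOver.map_comp, OperadMapOver.map_comp, ihx he, ihy ha]
      exact O.comp_shiftTo _ _ _ _ (by simp) _ _ _ _ _ _ _ _ _
  | act σ h x ih =>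
    change (shiftLeaves O hf F).map (T.operad.act σ h x) =
      O.shiftTo _ _ _ (F.map (T.operad.act σ h x))
    rw [OperadMapOver.map_act, OperadMapOver.map_act, ih he]
    exact O.act_shiftTo _ _ _ _ _ _ _ _

theorem continuous_shiftLeaves {T : PlanarTree} {f : T.Edge → Color}
    (hf : ∀ e, ¬ T.IsLeaf e → f e = Color.one) : Continuous (shiftLeaves O hf) :=
  continuous_freeLift _ fun _ _ _ =>
    (O.continuous_shiftTo _ _ _).comp (continuous_operadMap_apply (O := O.toTopOperad) _)

theorem color_apply_of_not_isLeaf {S T : PlanarTree} (α : S ⟶ T) (hα : Function.Injective α.col)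
    {e : S.Edge} (he : ¬ S.IsLeaf e) : ¬ T.IsLeaf (α.col e) := by
  intro h
  simp only [PlanarTree.IsLeaf, not_forall, not_not] at he
  obtain ⟨v, rfl⟩ := he
  obtain ⟨h', -⟩ := isLeaf_operation (α.hom.map (S.vertexOp v)) h
  have : α.col (S.out v) ∈ (S.inp v).map α.col := by rw [← h']; simp
  obtain ⟨e, he, he'⟩ := List.mem_map.1 this
  exact S.out_notMem_inp v (hα he' ▸ he)

/-- The operator `\hat α = 𝔰_S α^* : X_T → X_S` of a map `α : S → T` of `Ω_inj`. -/
noncomputable def hat {S T : PlanarTree} (α : S ⟶ T) (hα : Function.Injective α.col)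
    (F : XSpace O T) : XSpace O S :=
  shiftLeaves O (f := T.color ∘ α.col)
    (fun _ he => PlanarTree.color_of_not_isLeaf (color_apply_of_not_isLeaf α hα he))
    (F.comp α.hom)

theorem continuous_hat {S T : PlanarTree} (α : S ⟶ T) (hα : Function.Injective α.col) :
    Continuous (hat O α hα) := by
  refine (continuous_shiftLeaves O _).comp (continuous_induced_rng.2 (continuous_pi fun p => ?_))
  exact (continuous_recast (O := O.toTopOperad) (by simp) rfl).comp
    (continuous_operadMap_apply (O := O.toTopOperad) (α.hom.map p.2.2))

theorem hat_id (T : PlanarTree) (F : XSpace O T) : hat O (𝟙 T) Function.injective_id F = F := by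
  refine freeOperad_hom_ext fun l e g => ?_
  have he : ¬ T.IsLeaf e := fun h => h g.1 g.2.2
  refine (O.shiftTo_eq_recast (l := l.map (T.color ∘ _root_.id)) (c := (T.color ∘ _root_.id) e)
    (PlanarTree.color_of_not_isLeaf he) (PlanarTree.color_of_not_isLeaf he) _ rfl _).trans ?_
  refine (F.comp_mapTo (OperadMapOver.id T.operad) (l' := l) (c' := e) (List.map_id l) rfl rfl rfl
    rfl rfl (freeGen g)).trans ?_
  rw [OperadMapOver.id_mapTo]
  rfl

theorem hat_comp {R S T : PlanarTree} (β : R ⟶ S) (α : S ⟶ T) (hβ : Function.Injective β.col)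
    (hα : Function.Injective α.col) (F : XSpace O T) :
    hat O (β ≫ α) (hα.comp hβ) F = hat O β hβ (hat O α hα F) := by
  refine freeOperad_hom_ext fun l e g => ?_
  obtain ⟨v, rfl, rfl⟩ := g
  have hv := R.not_isLeaf_out v
  have hv' := color_apply_of_not_isLeaf β hβ hv
  have hv'' := color_apply_of_not_isLeaf α hα hv'
  have e₁ : (hat O β hβ (hat O α hα F)).map (R.vertexOp v) =
      O.shiftTo (PlanarTree.color_of_not_isLeaf hv') (PlanarTree.color_of_not_isLeaf hv)
        (listLE_color (f := S.color ∘ β.col) (fun _ he => PlanarTree.color_of_not_isLeaf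
          (color_apply_of_not_isLeaf β hβ he)) _)
        ((hat O α hα F).mapTo (by simp) rfl (β.hom.map (R.vertexOp v))) := rfl
  refine Eq.trans ?_ e₁.symm
  unfold OperadMapOver.mapTo hat
  have hle : ListLE ((R.inp v).map (T.color ∘ (α.col ∘ β.col))) ((R.inp v).map R.color) :=
    listLE_color (fun _ he => PlanarTree.color_of_not_isLeaf
      (color_apply_of_not_isLeaf α hα (color_apply_of_not_isLeaf β hβ he))) _
  have hmap : ((R.inp v).map β.col).map (T.color ∘ α.col) =
      (R.inp v).map (T.color ∘ (α.col ∘ β.col)) := by simp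
  have e₂ : (F.comp (α.hom.comp β.hom)).map (R.vertexOp v) =
      O.recast hmap rfl ((F.comp α.hom).map (β.hom.map (R.vertexOp v))) :=
    (F.mapTo_recast (l := ((R.inp v).map β.col).map α.col) (by simp) rfl _ rfl _).trans
      (F.recast_mapTo _ rfl _ _ _).symm
  rw [shiftLeaves_map O _ _ _ hv', O.recast_shiftTo]
  rw [O.shiftTo_shiftTo (h'' := hmap ▸ hle)]
  change O.shiftTo (PlanarTree.color_of_not_isLeaf hv'') (PlanarTree.color_of_not_isLeaf hv) hle
    ((F.comp (α.hom.comp β.hom)).map (R.vertexOp v)) = _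
  rw [e₂, O.shiftTo_recast]

/-- A semi-dendroidal space is a space-valued presheaf on `Ω_inj`. -/
abbrev SemiDendroidalSpace := OmegaInjᵒᵖ ⥤ TopCat.{u}

/-- The semi-dendroidal space `X` associated with an operad with shifts. -/
noncomputable def OperadWithShifts.associated : SemiDendroidalSpace.{u} where
  obj T := TopCat.of (XSpace O T.unop.obj)
  map α := TopCat.ofHom ⟨hat O α.unop.hom α.unop.property, continuous_hat O _ _⟩
  map_id _ := TopCat.hom_ext (ContinuousMap.ext fun F => hat_id O _ F)
  map_comp α β := TopCat.hom_ext (ContinuousMap.ext fun F => hat_comp O β.unop.hom α.unop.hom β.unop.property α.unop.property F)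

end Associated

/-! ### The Segal condition -/

section Segal

/-- The function on edges of the inclusion of the corolla at a vertex `v`: the root goes to the
output edge and the `i`-th leaf to the `i`-th input edge of `v`. -/
def PlanarTree.corollaEdge (T : PlanarTree) (v : T.Vertex) :
    (corolla (T.inp v).length).Edge → T.Edge
  | none => T.out v
  | some i => (T.inp v).get i

theorem PlanarTree.map_corollaEdge (T : PlanarTree) (v : T.Vertex) :
    ((List.finRange (T.inp v).length).map some).map (T.corollaEdge v) = T.inp v := by
  refine (List.map_map (f := some) (g := T.corollaEdge v)).trans ?_
  exact List.map_get_finRange (T.inp v)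

/-- The inclusion `C_v → T` of the corolla at a vertex `v`; it sends the vertex of `C_v` to `v`. -/
def PlanarTree.corollaHom (T : PlanarTree) (v : T.Vertex) :
    corolla (T.inp v).length ⟶ T where
  col := T.corollaEdge v
  hom := freeLift fun l e g =>
    T.operad.recast (by rw [← g.2.1]; exact (T.map_corollaEdge v).symm)
      (by rw [← g.2.2]; rfl) (T.vertexOp v)

theorem PlanarTree.corollaEdge_injective (T : PlanarTree) (v : T.Vertex) :
    Function.Injective (T.corollaEdge v) := by
  rintro (_ | i) (_ | j) h
  · rfl
  · have h : T.out v = (T.inp v).get j := h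
    exact absurd (h ▸ List.get_mem _ _) (T.out_notMem_inp v)
  · have h : (T.inp v).get i = T.out v := h
    exact absurd (h ▸ List.get_mem _ _) (T.out_notMem_inp v)
  · exact congrArg some ((T.inp_nodup v).injective_get h)

/-- The corolla inclusion `C_v → T` as a map of `Ω_inj`. -/
def PlanarTree.corollaInclusion (T : PlanarTree) (v : T.Vertex) :
    (⟨corolla (T.inp v).length⟩ : OmegaInj) ⟶ ⟨T⟩ :=
  ⟨T.corollaHom v, T.corollaEdge_injective v⟩

/-- The Segal map `Z_T → ∏_v Z_{C_v}` of a semi-dendroidal space. -/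
def segalMap (Z : SemiDendroidalSpace.{u}) (T : PlanarTree) :
    C(Z.obj (op ⟨T⟩),
      ∀ v : T.Vertex, Z.obj (op ⟨PlanarTree.corolla (T.inp v).length⟩)) :=
  ContinuousMap.pi fun v => (Z.map (T.corollaInclusion v).op).hom

/-- The Segal condition: `Z_η` is a point, and the Segal map of every tree other than `η` (that is,
of every tree with at least one vertex) is a weak homotopy equivalence. -/
def SegalCondition (Z : SemiDendroidalSpace.{u}) : Prop :=
  Nonempty (Unique (Z.obj (op ⟨PlanarTree.eta⟩))) ∧
    ∀ T : PlanarTree, Nonempty T.Vertex → IsWeakHomotopyEquiv (segalMap Z T)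

end Segal

end Dendro

/-!
An operad map out of the free operad `Ω(T)` is determined by its values at the vertices of `T`,
and these values are arbitrary; since the operad structure of `O` is continuous, this identifies
the space `X_T` with the product over the vertices `v` of the spaces of operations
`O(color (inp v); color (out v))` (`vertexHomeomorph`). For `T = η` the product is empty, so `X_η`
is a point. For `T ≠ η` the output of every vertex has colour `1`, and under these identifications,
for `T` and for the corollas `C_v`, the Segal map becomes the product of the shift maps
`O(color (inp v); 1) → O(2, …, 2; 1)` (`corollaHomeomorph_hat_corollaHom`). Each of them is a weak
homotopy equivalence by assumption, and weak homotopy equivalences are closed under products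
(`IsWeakHomotopyEquiv.piMap`) because paths and homotopies relative to the boundary in a product are
families of such in the factors.
-/

namespace Dendro

open CategoryTheory Opposite

/-! ### Closure properties of weak homotopy equivalences -/

section WeakEquivalence

variable {X Y Z : Type*} [TopologicalSpace X] [TopologicalSpace Y] [TopologicalSpace Z]

theorem IsWeakHomotopyEquiv.comp {g : C(Y, Z)} {f : C(X, Y)} (hg : IsWeakHomotopyEquiv g)
    (hf : IsWeakHomotopyEquiv f) : IsWeakHomotopyEquiv (g.comp f) := by
  refine ⟨?_, fun n x => ?_⟩
  · have h : pathComponentsMap (g.comp f) = pathComponentsMap g ∘ pathComponentsMap f := by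
      funext p
      induction p using Quotient.inductionOn
      rfl
    rw [h]
    exact hg.1.comp hf.1
  · have h : homotopyGroupMap (g.comp f) (Fin n) x =
        homotopyGroupMap g (Fin n) (f x) ∘ homotopyGroupMap f (Fin n) x := by
      funext p
      induction p using Quotient.inductionOn
      rfl
    rw [h]
    exact (hg.2 n (f x)).comp (hf.2 n x)

theorem isWeakHomotopyEquiv_homeomorph (e : X ≃ₜ Y) :
    IsWeakHomotopyEquiv (e : C(X, Y)) := by
  refine ⟨⟨fun p q => ?_, fun p => ?_⟩, fun n x => ⟨fun p q => ?_, fun p => ?_⟩⟩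
  · induction p using Quotient.inductionOn with | _ a
    induction q using Quotient.inductionOn with | _ b
    intro h
    have h' : Joined (e a) (e b) := Quotient.exact h
    have h'' : Joined a b := by simpa using h'.map e.symm.continuous
    exact Quotient.sound h''
  · induction p using Quotient.inductionOn with | _ b
    exact ⟨Quotient.mk _ (e.symm b), congrArg (Quotient.mk _) (e.apply_symm_apply b)⟩
  · induction p using Quotient.inductionOn with | _ a
    induction q using Quotient.inductionOn with | _ b
    intro h
    have h' := (show GenLoop.Homotopic (genLoopMap (e : C(X, Y)) (Fin n) x a)
      (genLoopMap (e : C(X, Y)) (Fin n) x b) from Quotient.exact h).comp_continuousMap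
        (e.symm : C(Y, X))
    have hc : ∀ c : C(Fin n → unitInterval, X),
        (e.symm : C(Y, X)).comp ((e : C(X, Y)).comp c) = c := fun c => by ext; simp
    simp only [genLoopMap, hc] at h'
    exact Quotient.sound h'
  · induction p using Quotient.inductionOn with | _ b
    refine ⟨Quotient.mk _ ⟨(e.symm : C(Y, X)).comp b.1, fun y hy => ?_⟩,
      congrArg (Quotient.mk _) (Subtype.ext ?_)⟩
    · exact (congrArg e.symm (b.2 y hy)).trans (e.symm_apply_apply x)
    · ext y
      exact e.apply_symm_apply _

/-- Weak homotopy equivalences are invariant under homeomorphisms of source and target. -/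
theorem IsWeakHomotopyEquiv.of_homeomorph {X' Y' : Type*} [TopologicalSpace X']
    [TopologicalSpace Y'] {f : C(X, Y)} {g : C(X', Y')} (hg : IsWeakHomotopyEquiv g)
    (e : X ≃ₜ X') (e' : Y ≃ₜ Y') (h : ∀ x, e' (f x) = g (e x)) : IsWeakHomotopyEquiv f := by
  have hf : f = (e'.symm : C(Y', Y)).comp (g.comp (e : C(X, X'))) := by
    ext x
    exact (e'.symm_apply_eq.2 (h x).symm).symm
  rw [hf]
  exact (isWeakHomotopyEquiv_homeomorph e'.symm).comp
    (hg.comp (isWeakHomotopyEquiv_homeomorph e))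

end WeakEquivalence

section Product

variable {ι : Type*} {A B : ι → Type*} [∀ i, TopologicalSpace (A i)] [∀ i, TopologicalSpace (B i)]

/-- The product of a family of continuous maps. -/
def piMap (f : ∀ i, C(A i, B i)) : C(∀ i, A i, ∀ i, B i) :=
  ContinuousMap.pi fun i => (f i).comp ⟨fun a => a i, continuous_apply i⟩

theorem joined_pi {a b : ∀ i, A i} (h : ∀ i, Joined (a i) (b i)) : Joined a b :=
  ⟨Path.pi fun i => (h i).somePath⟩

theorem homotopicRel_pi {W : Type*} [TopologicalSpace W] {S : Set W} {p q : C(W, ∀ i, A i)}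
    (h : ∀ i, ContinuousMap.HomotopicRel
      ((⟨fun a => a i, continuous_apply i⟩ : C(∀ i, A i, A i)).comp p)
      ((⟨fun a => a i, continuous_apply i⟩ : C(∀ i, A i, A i)).comp q) S) :
    ContinuousMap.HomotopicRel p q S :=
  ⟨ContinuousMap.HomotopyRel.pi fun i => (h i).some⟩

theorem IsWeakHomotopyEquiv.piMap {f : ∀ i, C(A i, B i)} (hf : ∀ i, IsWeakHomotopyEquiv (f i)) :
    IsWeakHomotopyEquiv (piMap f) := by
  refine ⟨⟨fun p q => ?_, fun p => ?_⟩, fun n x => ⟨fun p q => ?_, fun p => ?_⟩⟩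
  · induction p using Quotient.inductionOn with | _ a
    induction q using Quotient.inductionOn with | _ b
    intro h
    have h' : Joined (Dendro.piMap f a) (Dendro.piMap f b) := Quotient.exact h
    refine Quotient.sound (joined_pi fun i => ?_)
    have hi : Joined (f i (a i)) (f i (b i)) := h'.map (continuous_apply i)
    exact Quotient.exact ((hf i).1.1 (a₁ := Quotient.mk _ (a i)) (a₂ := Quotient.mk _ (b i))
      (Quotient.sound hi))
  · induction p using Quotient.inductionOn with | _ b
    have h : ∀ i, ∃ a : A i, Joined (f i a) (b i) := fun i => by
      obtain ⟨a, ha⟩ := (hf i).1.2 (Quotient.mk _ (b i))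
      induction a using Quotient.inductionOn with | _ a
      exact ⟨a, Quotient.exact ha⟩
    choose a ha using h
    exact ⟨Quotient.mk _ a, Quotient.sound (joined_pi ha)⟩
  · induction p using Quotient.inductionOn with | _ a
    induction q using Quotient.inductionOn with | _ b
    intro h
    have h' : GenLoop.Homotopic (genLoopMap (Dendro.piMap f) (Fin n) x a)
      (genLoopMap (Dendro.piMap f) (Fin n) x b) := Quotient.exact h
    refine Quotient.sound (homotopicRel_pi fun i => ?_)
    have hi := h'.comp_continuousMap (⟨fun c => c i, continuous_apply i⟩ : C(∀ i, B i, B i))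
    let π (c : GenLoop (Fin n) (∀ i, A i) x) : GenLoop (Fin n) (A i) (x i) :=
      genLoopMap ⟨fun c => c i, continuous_apply i⟩ (Fin n) x c
    have := (hf i).2 n (x i) |>.1 (a₁ := Quotient.mk _ (π a)) (a₂ := Quotient.mk _ (π b))
      (Quotient.sound hi)
    exact Quotient.exact this
  · induction p using Quotient.inductionOn with | _ b
    have h : ∀ i, ∃ a : GenLoop (Fin n) (A i) (x i),
        GenLoop.Homotopic (genLoopMap (f i) (Fin n) (x i) a)
          (genLoopMap ⟨fun c => c i, continuous_apply i⟩ (Fin n) (Dendro.piMap f x) b) :=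
      fun i => by
        obtain ⟨a, ha⟩ := ((hf i).2 n (x i)).2 (Quotient.mk _
          (genLoopMap ⟨fun c => c i, continuous_apply i⟩ (Fin n) (Dendro.piMap f x) b))
        induction a using Quotient.inductionOn with | _ a
        exact ⟨a, Quotient.exact ha⟩
    choose a ha using h
    exact ⟨Quotient.mk _ ⟨ContinuousMap.pi fun i => (a i).1,
      fun y hy => funext fun i => (a i).2 y hy⟩, Quotient.sound (homotopicRel_pi ha)⟩

end Product

/-! ### The spaces of the associated semi-dendroidal space -/

section Associated

variable (O : OperadWithShifts.{u})

theorem OperadWithShifts.isWeakHomotopyEquiv_shiftTo {l l' : List Color} {c c' : Color}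
    (hc : c = Color.one) (hc' : c' = Color.one) (h : ListLE l l') :
    IsWeakHomotopyEquiv (⟨O.shiftTo hc hc' h, O.continuous_shiftTo hc hc' h⟩ :
      C(O.Op l c, O.Op l' c')) := by
  subst hc hc'
  exact O.isWeakHomotopyEquiv_shift h

/-- Evaluation at the vertices identifies `X_T` with the product of the spaces of operations of
`O` with the input and output colours of the vertices of `T`. -/
noncomputable def vertexHomeomorph (T : PlanarTree) :
    XSpace O T ≃ₜ ∀ v : T.Vertex, O.Op ((T.inp v).map T.color) (T.color (T.out v)) where
  toFun F v := F.map (T.vertexOp v)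
  invFun φ := freeLift fun _ _ g =>
    O.recast (congrArg _ g.2.1) (congrArg _ g.2.2) (φ g.1)
  left_inv F := freeOperad_hom_ext fun _ _ ⟨_, hl, he⟩ => by
    subst hl he
    rfl
  right_inv _ := rfl
  continuous_toFun := continuous_pi fun _ => continuous_operadMap_apply (O := O.toTopOperad) _
  continuous_invFun := continuous_freeLift (O := O.toTopOperad) _ fun _ _ _ =>
    (continuous_recast (O := O.toTopOperad) _ _).comp (continuous_apply _)

/-- The space of a corolla is the space of operations at its only vertex. -/
noncomputable def corollaHomeomorph (k : ℕ) :
    XSpace O (PlanarTree.corolla k) ≃ₜ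
      O.Op (((PlanarTree.corolla k).inp ()).map (PlanarTree.corolla k).color)
        ((PlanarTree.corolla k).color ((PlanarTree.corolla k).out ())) :=
  (vertexHomeomorph O (PlanarTree.corolla k)).trans
    (Homeomorph.piUnique fun v : Unit => O.Op
      (((PlanarTree.corolla k).inp v).map (PlanarTree.corolla k).color)
      ((PlanarTree.corolla k).color ((PlanarTree.corolla k).out v)))

theorem PlanarTree.map_color_corollaEdge (T : PlanarTree) (v : T.Vertex) :
    ((PlanarTree.corolla (T.inp v).length).inp ()).map (T.color ∘ T.corollaEdge v) =
      (T.inp v).map T.color :=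
  List.map_map.symm.trans (congrArg (List.map T.color) (T.map_corollaEdge v))

/-- The list of colours at a vertex `v` of `T` is at most the list of colours of the corolla `C_v`,
all of whose inputs have the colour `2`. -/
theorem listLE_color_corolla (T : PlanarTree) (v : T.Vertex) :
    ListLE ((T.inp v).map T.color)
      (((PlanarTree.corolla (T.inp v).length).inp ()).map
        (PlanarTree.corolla (T.inp v).length).color) := by
  rw [← T.map_color_corollaEdge v]
  exact listLE_color (fun _ he => PlanarTree.color_of_not_isLeaf
    (color_apply_of_not_isLeaf (T.corollaHom v) (T.corollaEdge_injective v) he)) _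

/-- In terms of the values at vertices, the operator of the inclusion `C_v → T` is the projection to
the factor of `v` followed by the shift map that gives all inputs the colour `2`. -/
theorem corollaHomeomorph_hat_corollaHom (T : PlanarTree) (v : T.Vertex) (F : XSpace O T) :
    corollaHomeomorph O (T.inp v).length
        (hat O (T.corollaHom v) (T.corollaEdge_injective v) F) =
      O.shiftTo (PlanarTree.color_of_not_isLeaf (T.not_isLeaf_out v))
        (PlanarTree.color_of_not_isLeaf
          ((PlanarTree.corolla (T.inp v).length).not_isLeaf_out ()))
        (listLE_color_corolla T v) (vertexHomeomorph O T F v) := by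
  have e : (F.comp (T.corollaHom v).hom).map
        ((PlanarTree.corolla (T.inp v).length).vertexOp ()) =
      O.recast (T.map_color_corollaEdge v).symm rfl (F.map (T.vertexOp v)) :=
    F.mapTo_recast (T.map_corollaEdge v).symm rfl List.map_map rfl (T.vertexOp v)
  refine (shiftLeaves_map O (f := T.color ∘ T.corollaEdge v)
    (fun _ he => PlanarTree.color_of_not_isLeaf
      (color_apply_of_not_isLeaf (T.corollaHom v) (T.corollaEdge_injective v) he))
    (F.comp (T.corollaHom v).hom) ((PlanarTree.corolla (T.inp v).length).vertexOp ())
    (PlanarTree.not_isLeaf_out _ ())).trans ?_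
  refine (congrArg (O.shiftTo _ _ _) e).trans ?_
  exact O.shiftTo_recast _ _ _ _ _ _

end Associated

end Dendro

open Dendro in
theorem mainTheorem2 (O : Dendro.OperadWithShifts.{u}) :
    Dendro.SegalCondition O.associated := by
  refine ⟨?_, fun T _ => ?_⟩
  -- The tree `η` has no vertices, so its space is homeomorphic to an empty product.
  · have : IsEmpty PlanarTree.eta.Vertex := inferInstanceAs (IsEmpty Empty)
    exact ⟨(vertexHomeomorph O PlanarTree.eta).toEquiv.unique⟩
  · exact (IsWeakHomotopyEquiv.piMap fun v => O.isWeakHomotopyEquiv_shiftTo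
      (PlanarTree.color_of_not_isLeaf (T.not_isLeaf_out v))
      (PlanarTree.color_of_not_isLeaf
        ((PlanarTree.corolla (T.inp v).length).not_isLeaf_out ()))
      (listLE_color_corolla T v)).of_homeomorph
        (vertexHomeomorph O T)
        (Homeomorph.piCongrRight fun v => corollaHomeomorph O (T.inp v).length)
        fun F => funext fun v => corollaHomeomorph_hat_corollaHom O T v F
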